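/- Let $\mu$ be a Borel probability measure on $\mathbb{R}$ with $\int_{\mathbb{R}} x^2\,\mu(dx)<\infty$, and let $L^2(\mathbb{R},\mu)$ be the real Hilbert space of (classes of) square-integrable functions $\mathbb{R}\to\mathbb{R}$. Call $\Gamma\subset\mathbb{R}\times\mathbb{R}$ monotone if $(m_1-m_2)(x_1-x_2)\ge 0$ for all $(m_1,x_1),(m_2,x_2)\in\Gamma$. Let $\mathcal{C}$ be the set of all $X\in L^2(\mathbb{R},\mu)$ for which the support of the push-forward measure $(\mathrm{id},X)\#\mu$ is a monotone subset of $\mathbb{R}\times\mathbb{R}$; it is a closed convex cone, and $P_{\mathcal{C}}$ denotes the metric (nearest-point) projection of $L^2(\mathbb{R},\mu)$ onto $\mathcal{C}$. For $X\in L^2(\mathbb{R},\mu)$ let $H_X$ be the closure in $L^2(\mathbb{R},\mu)$ of the subspace $\{\varphi\circ X:\varphi\in C_c^\infty(\mathbb{R})\}$, and let $P_{H_X}$ be the orthogonal projection onto $H_X$. Proposition. Let $\bar X\in\mathcal{C}$ and $Y\in C([0,\infty),L^2(\mathbb{R},\mu))$, and define $$X_t := P_{\mathcal{C}}\Big(\bar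 X+\int_0^t Y_s\,ds\Big)\quad\text{for all } t\in[0,\infty).$$ Then for a.e. $t\in[0,\infty)$ the derivative $V_t$ of $t\mapsto X_t$ at $t$ exists (strongly, i.e. in the norm of $L^2(\mathbb{R},\mu)$) and satisfies $$V_t = P_{H_{X_t}}(Y_t).$$ -/

import Mathlib

open MeasureTheory Set Filter Topology

namespace StickyParticles

noncomputable section

/-! ### Metric projection onto a nonempty closed convex set -/

section Projection

variable {E : Type*} [NormedAddCommGroup E] [InnerProductSpace ℝ E] [CompleteSpace E]

/-- The nearest point of a nonempty closed convex subset `K` of a real Hilbert space to `y`: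
the element of `K` with `‖y - metricProj y‖ = inf {‖y - z‖ : z ∈ K}`. -/
def metricProj (K : Set E) (hne : K.Nonempty) (hcl : IsClosed K) (hconv : Convex ℝ K)
    (y : E) : E :=
  (exists_norm_eq_iInf_of_complete_convex hne hcl.isComplete hconv y).choose

theorem metricProj_spec (K : Set E) (hne : K.Nonempty) (hcl : IsClosed K)
    (hconv : Convex ℝ K) (y : E) :
    metricProj K hne hcl hconv y ∈ K ∧
      ‖y - metricProj K hne hcl hconv y‖ = ⨅ z : K, ‖y - z‖ :=
  (exists_norm_eq_iInf_of_complete_convex hne hcl.isComplete hconv y).choose_spec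

end Projection

/-! ### The cone of monotone maps in `L²(ℝ, μ)` -/

/-- A subset of the plane is monotone if `(m₁ - m₂) (x₁ - x₂) ≥ 0` for all its points
`(m₁, x₁)` and `(m₂, x₂)`. -/
def IsMonotoneSet (Γ : Set (ℝ × ℝ)) : Prop :=
  ∀ p ∈ Γ, ∀ q ∈ Γ, 0 ≤ (p.1 - q.1) * (p.2 - q.2)

/-- The transport plan `(id, X) # μ` induced by `X`. -/
def transportPlan (μ : Measure ℝ) (X : Lp ℝ 2 μ) : Measure (ℝ × ℝ) :=
  μ.map (fun m => (m, X m))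

/-- The set of all `X ∈ L²(ℝ, μ)` whose transport plan has monotone support. -/
def monotoneCone (μ : Measure ℝ) : Set (Lp ℝ 2 μ) :=
  {X | IsMonotoneSet (transportPlan μ X).support}

theorem measurable_graph {μ : Measure ℝ} (X : Lp ℝ 2 μ) :
    Measurable (fun m : ℝ => (m, X m)) :=
  measurable_id.prodMk (Lp.stronglyMeasurable X).measurable

theorem mem_monotoneCone_iff {μ : Measure ℝ} (X : Lp ℝ 2 μ) :
    X ∈ monotoneCone μ ↔
      ∃ s ∈ ae μ, ∀ m₁ ∈ s, ∀ m₂ ∈ s, 0 ≤ (m₁ - m₂) * (X m₁ - X m₂) := by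
  constructor
  · intro h
    have h1 : (transportPlan μ X).support ∈ ae (transportPlan μ X) :=
      Measure.support_mem_ae
    have h2 : (fun m : ℝ => (m, X m)) ⁻¹' (transportPlan μ X).support ∈ ae μ :=
      mem_ae_of_mem_ae_map (measurable_graph X).aemeasurable h1
    exact ⟨_, h2, fun m₁ h₁ m₂ h₂ => h _ h₁ _ h₂⟩
  · rintro ⟨s, hs, hmono⟩ p hp q hq
    by_contra! hneg
    have hopen : {z : (ℝ × ℝ) × (ℝ × ℝ) |
        (z.1.1 - z.2.1) * (z.1.2 - z.2.2) < 0} ∈ 𝓝 (p, q) :=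
      (isOpen_lt (by fun_prop) continuous_const).mem_nhds hneg
    rw [nhds_prod_eq, mem_prod_iff] at hopen
    obtain ⟨U, hU, V, hV, hUV⟩ := hopen
    have key : ∀ r ∈ (transportPlan μ X).support, ∀ W ∈ 𝓝 r, ∃ m ∈ s, (m, X m) ∈ W := by
      intro r hr W hW
      obtain ⟨O, hOW, hO, hrO⟩ := mem_nhds_iff.1 hW
      have hpos := (Measure.mem_support_iff_forall r).1 hr O (hO.mem_nhds hrO)
      rw [transportPlan, Measure.map_apply (measurable_graph X) hO.measurableSet] at hpos
      by_contra! hcon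
      refine hpos.ne' (measure_mono_null ?_ (mem_ae_iff.1 hs))
      intro m hm hms
      exact hcon m hms (hOW hm)
    obtain ⟨m₁, hm₁, hU₁⟩ := key p hp U hU
    obtain ⟨m₂, hm₂, hV₂⟩ := key q hq V hV
    have := hUV (Set.mk_mem_prod hU₁ hV₂)
    exact absurd (hmono m₁ hm₁ m₂ hm₂) (not_le.2 this)

theorem monotoneCone_nonempty (μ : Measure ℝ) : (monotoneCone μ).Nonempty := by
  refine ⟨0, (mem_monotoneCone_iff _).2 ⟨_, Lp.coeFn_zero ℝ 2 μ, fun m₁ h₁ m₂ h₂ => ?_⟩⟩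
  have h₁' : (0 : Lp ℝ 2 μ) m₁ = 0 := h₁
  have h₂' : (0 : Lp ℝ 2 μ) m₂ = 0 := h₂
  rw [h₁', h₂']
  simp

theorem convex_monotoneCone (μ : Measure ℝ) : Convex ℝ (monotoneCone μ) := by
  intro X hX Z hZ a b ha hb _
  obtain ⟨s, hs, hsX⟩ := (mem_monotoneCone_iff X).1 hX
  obtain ⟨t, ht, htZ⟩ := (mem_monotoneCone_iff Z).1 hZ
  have hae : ∀ᵐ m ∂μ, (a • X + b • Z : Lp ℝ 2 μ) m = a * X m + b * Z m := by
    filter_upwards [Lp.coeFn_add (a • X) (b • Z), Lp.coeFn_smul a X, Lp.coeFn_smul b Z]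
      with m h1 h2 h3
    rw [h1, Pi.add_apply, h2, h3]
    simp
  refine (mem_monotoneCone_iff _).2 ⟨_, inter_mem (inter_mem hs ht) hae, ?_⟩
  rintro m₁ ⟨⟨h1s, h1t⟩, h1⟩ m₂ ⟨⟨h2s, h2t⟩, h2⟩
  have h1' : (a • X + b • Z : Lp ℝ 2 μ) m₁ = a * X m₁ + b * Z m₁ := h1
  have h2' : (a • X + b • Z : Lp ℝ 2 μ) m₂ = a * X m₂ + b * Z m₂ := h2
  rw [h1', h2']
  have e1 := mul_nonneg ha (hsX m₁ h1s m₂ h2s)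
  have e2 := mul_nonneg hb (htZ m₁ h1t m₂ h2t)
  linarith

theorem isClosed_monotoneCone (μ : Measure ℝ) : IsClosed (monotoneCone μ) := by
  refine IsSeqClosed.isClosed fun F X hF hFX => ?_
  obtain ⟨ns, -, hns⟩ := (tendstoInMeasure_of_tendsto_Lp hFX).exists_seq_tendsto_ae
  choose s hs hmono using fun k => (mem_monotoneCone_iff (F k)).1 (hF k)
  have hall : ∀ᵐ m ∂μ, ∀ k, m ∈ s k := ae_all_iff.2 hs
  refine (mem_monotoneCone_iff X).2 ⟨_, inter_mem hall hns, ?_⟩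
  rintro m₁ ⟨h1, h1'⟩ m₂ ⟨h2, h2'⟩
  have h1'' : Tendsto (fun i => F (ns i) m₁) atTop (𝓝 (X m₁)) := h1'
  have h2'' : Tendsto (fun i => F (ns i) m₂) atTop (𝓝 (X m₂)) := h2'
  exact ge_of_tendsto' ((h1''.sub h2'').const_mul (m₁ - m₂))
    fun i => hmono (ns i) m₁ (h1 (ns i)) m₂ (h2 (ns i))

/-- The metric projection of `L²(ℝ, μ)` onto the cone of monotone maps. -/
def projCone (μ : Measure ℝ) (Z : Lp ℝ 2 μ) : Lp ℝ 2 μ :=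
  metricProj (monotoneCone μ) (monotoneCone_nonempty μ) (isClosed_monotoneCone μ)
    (convex_monotoneCone μ) Z

/-! ### The closed subspace generated by functions of `X` -/

open scoped ContDiff in
/-- The subspace `{φ ∘ X : φ ∈ C_c^∞(ℝ)}` of `L²(ℝ, μ)`; for finite `μ` each such `φ ∘ X` is
bounded, so its class does lie in `L²(ℝ, μ)`. -/
def testCompositions (μ : Measure ℝ) (X : Lp ℝ 2 μ) : Submodule ℝ (Lp ℝ 2 μ) where
  carrier := {W | ∃ φ : ℝ → ℝ, ContDiff ℝ ∞ φ ∧ HasCompactSupport φ ∧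
    ∀ᵐ m ∂μ, W m = φ (X m)}
  zero_mem' := by
    refine ⟨fun _ => 0, contDiff_const, HasCompactSupport.zero, ?_⟩
    filter_upwards [Lp.coeFn_zero ℝ 2 μ] with m hm
    rw [hm]; rfl
  add_mem' := by
    rintro V W ⟨φ, hφ, hφc, hV⟩ ⟨ψ, hψ, hψc, hW⟩
    refine ⟨fun x => φ x + ψ x, hφ.add hψ, hφc.add hψc, ?_⟩
    filter_upwards [Lp.coeFn_add V W, hV, hW] with m h1 h2 h3
    rw [h1, Pi.add_apply, h2, h3]
  smul_mem' := by
    rintro c W ⟨φ, hφ, hφc, hW⟩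
    refine ⟨fun x => c * φ x, contDiff_const.mul hφ, hφc.mul_left (f := fun _ => c), ?_⟩
    filter_upwards [Lp.coeFn_smul c W, hW] with m h1 h2
    rw [h1, Pi.smul_apply, h2, smul_eq_mul]

/-- The closed subspace `H_X`: the `L²(ℝ, μ)`-closure of `{φ ∘ X : φ ∈ C_c^∞(ℝ)}`. -/
abbrev closedSpan (μ : Measure ℝ) (X : Lp ℝ 2 μ) : Submodule ℝ (Lp ℝ 2 μ) :=
  (testCompositions μ X).topologicalClosure

end

end StickyParticles

namespace StickyParticles

/-! The free curve `Z t = Xbar + ∫ Y` is locally Lipschitz and the projection is nonexpansive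
(`norm_projCone_sub_le`), so `X` is locally Lipschitz in a separable Hilbert space, hence
differentiable almost everywhere. Fix such a `t > 0`, with velocity `V`.

Membership: `V` and `-V` are both limits of directions that stay in the cone, so on level sets of `X
t` the function `V` is nondecreasing and nonincreasing, hence constant
(`exists_ae_velocity_eq_on_levels`). It is therefore a Borel function of `X t` and lies in
`closedSpan μ (X t)` (`mem_closedSpan_of_eq_on_levels`).

Orthogonality: `Z s - X s` is orthogonal to `φ ∘ X s` for every `s ≥ 0`
(`inner_sub_projCone_eq_zero`). Formally, differentiating at `t` gives `⟨Y t - V, φ ∘ X t⟩ + ⟨Z t -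
X t, φ'(X t) V⟩ = 0`, and the second term vanishes since `φ'(X t) V` is again a function of `X t`.
`inner_deriv_eq_zero` carries this out without `φ'`. So `V` is the orthogonal projection of `Y t`.
-/

theorem countable_of_orthonormal {E ι : Type*} [NormedAddCommGroup E] [InnerProductSpace ℝ E]
    [TopologicalSpace.SeparableSpace E] {b : ι → E} (hb : Orthonormal ℝ b) : Countable ι := by
  have hdist : ∀ i j, i ≠ j → 1 < ‖b i - b j‖ ^ 2 := by
    intro i j hij
    rw [norm_sub_sq_real, hb.1 i, hb.1 j, hb.2 hij]
    norm_num
  have hdisj : Pairwise (Function.onFun Disjoint fun i => Metric.ball (b i) (1 / 2)) := by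
    intro i j hij
    refine Metric.ball_disjoint_ball ?_
    rw [dist_eq_norm]
    nlinarith [hdist i j hij, norm_nonneg (b i - b j)]
  exact hdisj.countable_of_isOpen_disjoint (fun i => Metric.isOpen_ball)
    (fun i => ⟨b i, Metric.mem_ball_self (by norm_num)⟩)

/-! ### Almost everywhere differentiability of Lipschitz curves in a separable Hilbert space -/

section Rademacher

variable {E : Type*} [NormedAddCommGroup E] [InnerProductSpace ℝ E]

/-- Bessel's inequality for the difference quotients, whose norms are at most `K`, passed to the
limit. -/
theorem sum_sq_deriv_inner_le {ι : Type*} {b : ι → E} (hb : Orthonormal ℝ b) {f : ℝ → E}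
    {K : NNReal} (hf : LipschitzWith K f) {t : ℝ}
    (hd : ∀ i, DifferentiableAt ℝ (fun s => inner ℝ (b i) (f s)) t) (s : Finset ι) :
    ∑ i ∈ s, (deriv (fun s => inner ℝ (b i) (f s)) t) ^ 2 ≤ (K : ℝ) ^ 2 := by
  have hlim : Tendsto (fun h : ℝ => ∑ i ∈ s, (inner ℝ (b i) (h⁻¹ • (f (t + h) - f t))) ^ 2)
      (𝓝[≠] 0) (𝓝 (∑ i ∈ s, (deriv (fun s => inner ℝ (b i) (f s)) t) ^ 2)) := by
    refine tendsto_finsetSum _ fun i _ => Tendsto.pow ?_ 2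
    have := (hd i).hasDerivAt.tendsto_slope_zero
    simpa only [inner_smul_right, inner_sub_right, smul_eq_mul] using this
  refine le_of_tendsto hlim ?_
  filter_upwards [self_mem_nhdsWithin] with h hh
  have h1 := hb.sum_inner_products_le (s := s) (h⁻¹ • (f (t + h) - f t))
  simp only [Real.norm_eq_abs, sq_abs] at h1
  refine h1.trans ?_
  have h2 : ‖f (t + h) - f t‖ ≤ K * |h| := by
    have := hf.dist_le_mul (t + h) t
    rwa [dist_eq_norm, Real.dist_eq, add_sub_cancel_left] at this
  have h3 : 0 < |h| := abs_pos.2 hh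
  refine pow_le_pow_left₀ (norm_nonneg _) ?_ 2
  rw [norm_smul, norm_inv, Real.norm_eq_abs, inv_mul_le_iff₀ h3]
  linarith

/-- Lipschitz curves in a separable Hilbert space are differentiable almost everywhere. -/
theorem ae_differentiableAt_of_lipschitzWith [CompleteSpace E]
    [TopologicalSpace.SeparableSpace E] {f : ℝ → E}
    {K : NNReal} (hf : LipschitzWith K f) : ∀ᵐ t, DifferentiableAt ℝ f t := by
  obtain ⟨w, b, -⟩ := exists_hilbertBasis ℝ E
  have hb := b.orthonormal
  have : Countable w := countable_of_orthonormal hb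
  have hlip : ∀ i, LipschitzWith (‖innerSL ℝ (b i)‖₊ * K) (fun s => inner ℝ (b i) (f s)) := fun i =>
    (innerSL ℝ (b i)).lipschitz.comp hf
  have hd : ∀ᵐ t, ∀ i, DifferentiableAt ℝ (fun s => inner ℝ (b i) (f s)) t :=
    ae_all_iff.2 fun i => by
      filter_upwards [(hlip i).ae_differentiableAt_real] with t ht using ht
  let c : w → ℝ → ℝ := fun i => deriv (fun s => inner ℝ (b i) (f s))
  -- The coordinate derivatives are square summable, so they assemble into a vector; the value 0 at
  -- bad times keeps the bound valid everywhere.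
  have hv : ∀ t, ∃ v : E, ‖v‖ ≤ K ∧ ((∀ i, DifferentiableAt ℝ (fun s => inner ℝ (b i) (f s)) t) →
      ∀ i, inner ℝ (b i) v = c i t) := by
    intro t
    by_cases ht : ∀ i, DifferentiableAt ℝ (fun s => inner ℝ (b i) (f s)) t
    · have hle := sum_sq_deriv_inner_le hb hf ht
      have hmem : Memℓp (fun i => c i t) 2 := by
        refine memℓp_gen' (C := (K : ℝ) ^ 2) fun s => ?_
        simpa using hle s
      refine ⟨b.repr.symm ⟨_, hmem⟩, ?_, fun _ i => ?_⟩
      · rw [LinearIsometryEquiv.norm_map]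
        refine lp.norm_le_of_forall_sum_le (by norm_num) K.2 fun s => ?_
        simpa using hle s
      · rw [← b.repr_apply_apply]; simp
    · exact ⟨0, by simp, fun h => absurd h ht⟩
  choose v hvK hvc using hv
  have hvm : AEStronglyMeasurable v volume := by
    refine aestronglyMeasurable_of_tendsto_ae atTop
      (f := fun (s : Finset w) t => ∑ i ∈ s, c i t • b i) (fun s => ?_) ?_
    · refine Finset.aestronglyMeasurable_fun_sum _ fun i _ => ?_
      exact (stronglyMeasurable_deriv _).aestronglyMeasurable.smul_const _
    · filter_upwards [hd] with t ht
      have := b.hasSum_repr (v t)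
      simp only [b.repr_apply_apply, hvc t ht] at this
      exact this
  have hvi : LocallyIntegrable v := by
    refine (locallyIntegrable_const (K : ℝ)).mono hvm (.of_forall fun t => ?_)
    simpa using hvK t
  -- Checked in each coordinate, where a scalar Lipschitz function is the integral of its
  -- derivative. Lebesgue differentiation then concludes.
  have hint : ∀ t, ∫ s in (0:ℝ)..t, v s = f t - f 0 := by
    intro t
    apply b.repr.injective
    ext i
    rw [b.repr_apply_apply, b.repr_apply_apply, ← innerSL_apply_apply ℝ,
      ← ContinuousLinearMap.intervalIntegral_comp_comm _ (hvi.integrableOn_isCompact isCompact_uIcc).intervalIntegrable]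
    have h1 : ∫ s in (0:ℝ)..t, c i s = inner ℝ (b i) (f t) - inner ℝ (b i) (f 0) :=
      ((hlip i).lipschitzOnWith (s := uIcc 0 t)).absolutelyContinuousOnInterval.integral_deriv_eq_sub
    rw [inner_sub_right, ← h1]
    refine intervalIntegral.integral_congr_ae ?_
    filter_upwards [hd] with s hs _ using hvc s hs i
  filter_upwards [LocallyIntegrable.ae_hasDerivAt_integral hvi] with t ht
  have h2 := (ht 0).add_const (f 0)
  simp only [hint, sub_add_cancel] at h2
  exact h2.differentiableAt

/-- Locally Lipschitz curves on the half line. -/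
theorem ae_differentiableAt_of_lipschitzOnWith_Icc [CompleteSpace E]
    [TopologicalSpace.SeparableSpace E] {f : ℝ → E}
    (hf : ∀ T : ℝ, 0 ≤ T → ∃ K, LipschitzOnWith K f (Icc 0 T)) :
    ∀ᵐ t, 0 < t → DifferentiableAt ℝ f t := by
  have key : ∀ n : ℕ, ∀ᵐ t, t ∈ Ioo (0:ℝ) n → DifferentiableAt ℝ f t := by
    intro n
    have hn : (0:ℝ) ≤ n := n.cast_nonneg
    obtain ⟨K, hK⟩ := hf n hn
    -- Freezing the curve outside `[0, n]` makes it globally Lipschitz without changing it near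
    -- interior points.
    have hl : LipschitzWith (K * 1) (IccExtend hn (domRestrict (Icc (0:ℝ) n) f)) :=
      hK.to_restrict.comp (LipschitzWith.projIcc hn)
    filter_upwards [ae_differentiableAt_of_lipschitzWith hl] with t ht htn
    refine ht.congr_of_eventuallyEq ?_
    filter_upwards [Ioo_mem_nhds htn.1 htn.2] with s hs
    rw [IccExtend_of_mem _ _ (Ioo_subset_Icc_self hs)]
    rfl
  filter_upwards [ae_all_iff.2 key] with t ht h0
  obtain ⟨n, hn⟩ := exists_nat_gt t
  exact ht n ⟨h0, hn⟩

end Rademacher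

/-! ### The metric projection onto the monotone cone -/

theorem projCone_mem (μ : Measure ℝ) (Z : Lp ℝ 2 μ) : projCone μ Z ∈ monotoneCone μ :=
  (metricProj_spec _ _ _ _ Z).1

theorem inner_sub_projCone_le {μ : Measure ℝ} (Z : Lp ℝ 2 μ) {U : Lp ℝ 2 μ}
    (hU : U ∈ monotoneCone μ) : inner ℝ (Z - projCone μ Z) (U - projCone μ Z) ≤ 0 :=
  (norm_eq_iInf_iff_real_inner_le_zero (convex_monotoneCone μ) (projCone_mem μ Z)).1
    (metricProj_spec _ _ _ _ Z).2 U hU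

theorem norm_projCone_sub_le {μ : Measure ℝ} (Z W : Lp ℝ 2 μ) :
    ‖projCone μ Z - projCone μ W‖ ≤ ‖Z - W‖ := by
  have h1 := inner_sub_projCone_le Z (projCone_mem μ W)
  have h2 := inner_sub_projCone_le W (projCone_mem μ Z)
  set P := projCone μ Z
  set Q := projCone μ W
  have h3 : inner ℝ (P - Q) (P - Q) ≤ inner ℝ (Z - W) (P - Q) := by
    have e1 : inner ℝ (Z - P) (Q - P) = - inner ℝ (Z - P) (P - Q) := by
      rw [← inner_neg_right, neg_sub]
    have e2 : inner ℝ (Z - W) (P - Q) - inner ℝ (P - Q) (P - Q)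
        = inner ℝ (Z - P) (P - Q) - inner ℝ (W - Q) (P - Q) := by
      rw [← inner_sub_left, ← inner_sub_left]
      congr 1
      abel
    linarith
  rw [real_inner_self_eq_norm_sq] at h3
  have h4 := real_inner_le_norm (Z - W) (P - Q)
  by_contra! hlt
  have : 0 < ‖P - Q‖ := (norm_nonneg _).trans_lt hlt
  nlinarith

/-- The bound on `ε` makes `x ↦ x + ε φ(x)` nondecreasing, for either sign of `ε`, and nondecreasing
maps preserve monotonicity. -/
theorem add_smul_mem_monotoneCone {μ : Measure ℝ} {X W : Lp ℝ 2 μ} (hX : X ∈ monotoneCone μ)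
    {φ : ℝ → ℝ} {K : NNReal} (hφ : LipschitzWith K φ) (hW : ∀ᵐ m ∂μ, W m = φ (X m))
    {ε : ℝ} (hε : |ε| * K ≤ 1) : X + ε • W ∈ monotoneCone μ := by
  obtain ⟨s, hs, hmono⟩ := (mem_monotoneCone_iff X).1 hX
  have hae : ∀ᵐ m ∂μ, (X + ε • W : Lp ℝ 2 μ) m = X m + ε * φ (X m) := by
    filter_upwards [Lp.coeFn_add X (ε • W), Lp.coeFn_smul ε W, hW] with m h1 h2 h3
    rw [h1, Pi.add_apply, h2, Pi.smul_apply, h3, smul_eq_mul]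
  refine (mem_monotoneCone_iff _).2 ⟨_, inter_mem hs hae, ?_⟩
  rintro m₁ ⟨h1s, h1⟩ m₂ ⟨h2s, h2⟩
  rw [show (X + ε • W : Lp ℝ 2 μ) m₁ = _ from h1, show (X + ε • W : Lp ℝ 2 μ) m₂ = _ from h2]
  have hd := hmono m₁ h1s m₂ h2s
  have hy : |ε * (φ (X m₁) - φ (X m₂))| ≤ |X m₁ - X m₂| := by
    have := hφ.dist_le_mul (X m₁) (X m₂)
    rw [Real.dist_eq, Real.dist_eq] at this
    rw [abs_mul]
    calc |ε| * |φ (X m₁) - φ (X m₂)| ≤ |ε| * (K * |X m₁ - X m₂|) := by gcongr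
      _ = |ε| * K * |X m₁ - X m₂| := by ring
      _ ≤ 1 * |X m₁ - X m₂| := by gcongr
      _ = _ := one_mul _
  have e : X m₁ + ε * φ (X m₁) - (X m₂ + ε * φ (X m₂))
      = (X m₁ - X m₂) + ε * (φ (X m₁) - φ (X m₂)) := by ring
  rw [e]
  generalize ε * (φ (X m₁) - φ (X m₂)) = y at *
  generalize X m₁ - X m₂ = x at *
  obtain ⟨hy1, hy2⟩ := abs_le.1 hy
  rcases lt_trichotomy x 0 with hx | rfl | hx
  · rw [abs_of_neg hx] at hy1 hy2
    exact mul_nonneg_of_nonpos_of_nonpos (by nlinarith) (by linarith)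
  · have : y = 0 := by simpa using hy
    simp [this]
  · rw [abs_of_pos hx] at hy1 hy2
    exact mul_nonneg (by nlinarith) (by linarith)

/-- The residual of the projection onto the cone is orthogonal to all functions of the
projection. -/
theorem inner_sub_projCone_eq_zero {μ : Measure ℝ} (Z : Lp ℝ 2 μ) {W : Lp ℝ 2 μ}
    (hW : W ∈ closedSpan μ (projCone μ Z)) : inner ℝ (Z - projCone μ Z) W = 0 := by
  have hle : closedSpan μ (projCone μ Z) ≤ (ℝ ∙ (Z - projCone μ Z))ᗮ := by
    refine Submodule.topologicalClosure_minimal _ ?_ (Submodule.isClosed_orthogonal _)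
    rintro W ⟨φ, hφ, hφc, hW⟩
    rw [Submodule.mem_orthogonal_singleton_iff_inner_right]
    obtain ⟨K, hK⟩ := hφ.lipschitzWith_of_hasCompactSupport hφc (by simp)
    have key : ∀ ε : ℝ, |ε| * K ≤ 1 → ε * inner ℝ (Z - projCone μ Z) W ≤ 0 := by
      intro ε hε
      have := inner_sub_projCone_le Z
        (add_smul_mem_monotoneCone (projCone_mem μ Z) hK hW hε)
      rwa [add_sub_cancel_left, inner_smul_right] at this
    have hpos : (0:ℝ) < (K + 1 : ℝ)⁻¹ := by positivity
    have hle : (K + 1 : ℝ)⁻¹ * K ≤ 1 := by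
      rw [inv_mul_le_iff₀ (by positivity)]; linarith
    have h1 := key (K + 1 : ℝ)⁻¹ (by rwa [abs_of_pos hpos])
    have h2 := key (-(K + 1 : ℝ)⁻¹) (by rwa [abs_neg, abs_of_pos hpos])
    have h3 : (K + 1 : ℝ)⁻¹ * inner ℝ (Z - projCone μ Z) W = 0 := by linarith
    exact (mul_eq_zero.1 h3).resolve_left hpos.ne'
  exact (Submodule.mem_orthogonal_singleton_iff_inner_right).1 (hle hW)

/-! ### Functions constant on the level sets of `X` -/

theorem exists_measurable_comp_of_eq_on_levels {α : Type*} [MeasurableSpace α]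
    [StandardBorelSpace α] {f g : α → ℝ} (hf : Measurable f) (hg : Measurable g)
    (hfg : ∀ x y, f x = f y → g x = g y) : ∃ h : ℝ → ℝ, Measurable h ∧ g = h ∘ f := by
  have hF : Measurable (rangeFactorization f) := by fun_prop
  have hsurj : Function.Surjective (rangeFactorization f) := rangeFactorization_surjective
  have hv : g = (g ∘ Function.surjInv hsurj) ∘ rangeFactorization f := by
    funext x
    refine hfg _ _ ?_
    exact congrArg Subtype.val (Function.surjInv_eq hsurj (rangeFactorization f x)).symm
  -- A measurable surjection from a standard Borel space detects measurability of functions on its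
  -- image.
  have hvm : Measurable (g ∘ Function.surjInv hsurj) := by
    rw [← hF.measurable_comp_iff_of_surjective hsurj, ← hv]
    exact hg
  have hc : Measurable[MeasurableSpace.comap f inferInstance] g := by
    rw [hv]
    refine hvm.comp ?_
    exact Measurable.subtype_mk (comap_measurable f)
  exact hc.exists_eq_measurable_comp

/-- Composition with `X` is an isometry from `L²(X # μ)` into `L²(μ)`, and `C_c^∞` is dense in the
former. -/
theorem comp_mem_closedSpan {μ : Measure ℝ} [IsFiniteMeasure μ] {X g : Lp ℝ 2 μ} {h : ℝ → ℝ}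
    (hh : Measurable h) (hg : ∀ᵐ m ∂μ, g m = h (X m)) : g ∈ closedSpan μ X := by
  have hXm : Measurable X := (Lp.stronglyMeasurable X).measurable
  have hmp : MeasurePreserving X μ (μ.map X) := hXm.measurePreserving μ
  have hL : MemLp h 2 (μ.map X) := by
    rw [memLp_map_measure_iff hh.aestronglyMeasurable hXm.aemeasurable]
    exact (memLp_congr_ae hg).1 (Lp.memLp g)
  let T := Lp.compMeasurePreservingₗᵢ (p := 2) ℝ (E := ℝ) X hmp
  have hT : T hL.toLp = g := by
    refine Lp.ext ?_
    have h1 : (T hL.toLp : ℝ → ℝ) =ᵐ[μ] hL.toLp ∘ X := Lp.coeFn_compMeasurePreserving _ hmp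
    have h2 := hmp.quasiMeasurePreserving.ae_eq_comp hL.coeFn_toLp
    filter_upwards [h1, h2, hg] with m a b c
    rw [a, b, c]; rfl
  rw [← hT]
  have hd := Lp.dense_hasCompactSupport_contDiff (F := ℝ) (μ := μ.map X) (p := 2) (by simp)
    hL.toLp
  refine map_mem_closure T.continuous hd ?_
  rintro f ⟨φ, hf, hφc, hφ⟩
  refine ⟨φ, hφ, hφc, ?_⟩
  have h1 : (T f : ℝ → ℝ) =ᵐ[μ] f ∘ X := Lp.coeFn_compMeasurePreserving _ hmp
  have h2 := hmp.quasiMeasurePreserving.ae_eq_comp hf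
  filter_upwards [h1, h2] with m a b
  rw [a, b]; rfl

theorem mem_closedSpan_of_eq_on_levels {μ : Measure ℝ} [IsFiniteMeasure μ] {X g : Lp ℝ 2 μ}
    {s : Set ℝ} (hs : s ∈ ae μ) (hg : ∀ m₁ ∈ s, ∀ m₂ ∈ s, X m₁ = X m₂ → g m₁ = g m₂) :
    g ∈ closedSpan μ X := by
  obtain ⟨u, hum, hu, hus⟩ := IsMeasurablyGenerated.exists_measurable_subset hs
  have := hu.standardBorel
  have hXm : Measurable X := (Lp.stronglyMeasurable X).measurable
  have hgm : Measurable g := (Lp.stronglyMeasurable g).measurable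
  obtain ⟨h, hh, hgh⟩ := exists_measurable_comp_of_eq_on_levels
    (f := fun x : u => X x) (g := fun x : u => g x)
    (hXm.comp measurable_subtype_coe) (hgm.comp measurable_subtype_coe)
    (fun x y => hg x (hus x.2) y (hus y.2))
  refine comp_mem_closedSpan hh ?_
  filter_upwards [hum] with m hm using congrFun hgh ⟨m, hm⟩

/-- A limit of feasible directions at `A` is monotone on the level sets of `A`. -/
theorem exists_ae_monotone_on_levels {μ : Measure ℝ} {A V : Lp ℝ 2 μ} {Q : ℕ → Lp ℝ 2 μ}
    {ε : ℕ → ℝ} (hε : ∀ n, 0 < ε n) (hQ : Tendsto Q atTop (𝓝 V))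
    (hmem : ∀ n, A + ε n • Q n ∈ monotoneCone μ) :
    ∃ s ∈ ae μ, ∀ m₁ ∈ s, ∀ m₂ ∈ s, A m₁ = A m₂ → 0 ≤ (m₁ - m₂) * (V m₁ - V m₂) := by
  obtain ⟨ns, -, hns⟩ := (tendstoInMeasure_of_tendsto_Lp hQ).exists_seq_tendsto_ae
  choose s hs hmono using fun k => (mem_monotoneCone_iff _).1 (hmem k)
  have hall : ∀ᵐ m ∂μ, ∀ k, m ∈ s k := ae_all_iff.2 hs
  have hadd : ∀ᵐ m ∂μ, ∀ k, (A + ε k • Q k : Lp ℝ 2 μ) m = A m + ε k * Q k m := by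
    refine ae_all_iff.2 fun k => ?_
    filter_upwards [Lp.coeFn_add A (ε k • Q k), Lp.coeFn_smul (ε k) (Q k)] with m h1 h2
    rw [h1, Pi.add_apply, h2, Pi.smul_apply, smul_eq_mul]
  refine ⟨_, inter_mem (inter_mem hall hadd) hns, ?_⟩
  rintro m₁ ⟨⟨h1, h1a⟩, h1t⟩ m₂ ⟨⟨h2, h2a⟩, h2t⟩ hA
  have h1t' : Tendsto (fun i => Q (ns i) m₁) atTop (𝓝 (V m₁)) := h1t
  have h2t' : Tendsto (fun i => Q (ns i) m₂) atTop (𝓝 (V m₂)) := h2t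
  refine ge_of_tendsto' ((h1t'.sub h2t').const_mul (m₁ - m₂)) fun i => ?_
  have h := hmono (ns i) m₁ (h1 _) m₂ (h2 _)
  -- On a level set the contribution of `A` cancels, and the factor `ε > 0` can be divided out.
  rw [h1a (ns i), h2a (ns i), hA, add_sub_add_left_eq_sub, ← mul_sub, mul_left_comm] at h
  exact nonneg_of_mul_nonneg_right h (hε _)

/-- The velocity of a curve in the cone is constant on the level sets of the position. -/
theorem exists_ae_velocity_eq_on_levels {μ : Measure ℝ} {X : ℝ → Lp ℝ 2 μ} {V : Lp ℝ 2 μ}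
    {t : ℝ} (ht : 0 < t) (hmem : ∀ s, 0 ≤ s → X s ∈ monotoneCone μ) (hV : HasDerivAt X V t) :
    ∃ s ∈ ae μ, ∀ m₁ ∈ s, ∀ m₂ ∈ s, X t m₁ = X t m₂ → V m₁ = V m₂ := by
  obtain ⟨ε, hpos, hle, hlim⟩ : ∃ ε : ℕ → ℝ, (∀ n, 0 < ε n) ∧ (∀ n, ε n ≤ t) ∧
      Tendsto ε atTop (𝓝 0) := by
    -- Steps of size at most `t` keep `t - ε n` in the half line.
    refine ⟨fun n => t * (1 / ((n : ℝ) + 1)), fun n => by positivity, fun n => ?_, ?_⟩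
    · refine mul_le_of_le_one_right ht.le ?_
      rw [div_le_one (by positivity)]
      linarith [n.cast_nonneg (α := ℝ)]
    · simpa using (tendsto_one_div_add_atTop_nhds_zero_nat (𝕜 := ℝ)).const_mul t
  have hsl := hV.tendsto_slope_zero
  have h1 := hsl.comp (tendsto_nhdsWithin_iff.2 ⟨hlim, .of_forall fun n => (hpos n).ne'⟩)
  have h2 := hsl.comp (tendsto_nhdsWithin_iff.2
    ⟨by rw [← neg_zero]; exact hlim.neg, .of_forall fun n => (neg_lt_zero.2 (hpos n)).ne⟩)
  obtain ⟨s₁, hs₁, hm₁⟩ := exists_ae_monotone_on_levels (A := X t) hpos h1 fun n => by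
    have : X t + ε n • ((ε n)⁻¹ • (X (t + ε n) - X t)) = X (t + ε n) := by
      rw [smul_inv_smul₀ (hpos n).ne']; abel
    simp only [Function.comp_apply, this]
    exact hmem _ (by linarith [hpos n])
  obtain ⟨s₂, hs₂, hm₂⟩ := exists_ae_monotone_on_levels (A := X t) hpos h2.neg fun n => by
    have : X t + ε n • (-((-ε n)⁻¹ • (X (t + -ε n) - X t))) = X (t + -ε n) := by
      rw [inv_neg, neg_smul, neg_neg, smul_inv_smul₀ (hpos n).ne']; abel
    simp only [Function.comp_apply, this]
    exact hmem _ (by linarith [hle n])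
  refine ⟨_, inter_mem (inter_mem hs₁ hs₂) (Lp.coeFn_neg V), ?_⟩
  rintro m₁ ⟨⟨a1, a2⟩, a3⟩ m₂ ⟨⟨b1, b2⟩, b3⟩ hX
  have c1 := hm₁ m₁ a1 m₂ b1 hX
  have c2 := hm₂ m₁ a2 m₂ b2 hX
  rw [show (-V : Lp ℝ 2 μ) m₁ = -V m₁ from a3, show (-V : Lp ℝ 2 μ) m₂ = -V m₂ from b3] at c2
  have : (m₁ - m₂) * (V m₁ - V m₂) = 0 := by linarith
  rcases mul_eq_zero.1 this with h | h
  · rw [sub_eq_zero.1 h]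
  · exact sub_eq_zero.1 h

/-! ### Composition with Lipschitz functions -/

section Composition

variable {μ : Measure ℝ} [IsFiniteMeasure μ]

theorem exists_norm_sub_le_of_lipschitz {φ : ℝ → ℝ} {K : NNReal} (hφ : LipschitzWith K φ) :
    ∃ F : Lp ℝ 2 μ → Lp ℝ 2 μ, (∀ U, ∀ᵐ m ∂μ, F U m = φ (U m)) ∧
      ∀ U U', ‖F U - F U'‖ ≤ K * ‖U - U'‖ := by
  have hL : ∀ U : Lp ℝ 2 μ, MemLp (fun m => φ (U m)) 2 μ := by
    intro U
    have h0 : LipschitzWith K (fun x => φ x - φ 0) := by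
      simpa using hφ.sub (LipschitzWith.const (φ 0))
    have h1 := (h0.comp_memLp (by simp) (Lp.memLp U)).add (memLp_const (φ 0))
    convert h1 using 1
    ext m
    simp
  refine ⟨fun U => (hL U).toLp, fun U => (hL U).coeFn_toLp, fun U U' => ?_⟩
  refine Lp.norm_le_mul_norm_of_ae_le_mul ?_
  filter_upwards [Lp.coeFn_sub (hL U).toLp (hL U').toLp, Lp.coeFn_sub U U', (hL U).coeFn_toLp,
    (hL U').coeFn_toLp] with m h1 h2 h3 h4
  rw [h1, h2, Pi.sub_apply, Pi.sub_apply, h3, h4, ← dist_eq_norm, ← dist_eq_norm]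
  exact hφ.dist_le_mul _ _

end Composition

/-! ### Identification of the velocity -/

/-- If `W s` annihilates `F (X s)` for all `s`, and `W t` annihilates `F` along the tangent line
to `X` at `t`, then the derivative of `W` at `t` annihilates `F (X t)`. -/
theorem inner_deriv_eq_zero {E : Type*} [NormedAddCommGroup E] [InnerProductSpace ℝ E]
    {X W : ℝ → E} {V D : E} {t : ℝ} {F : E → E} {K : ℝ}
    (hF : ∀ U U', ‖F U - F U'‖ ≤ K * ‖U - U'‖)
    (hV : HasDerivAt X V t) (hD : HasDerivAt W D t)
    (hX : ∀ᶠ s in 𝓝 t, inner ℝ (W s) (F (X s)) = 0)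
    (hline : ∀ h : ℝ, inner ℝ (W t) (F (X t + h • V)) = 0) :
    inner ℝ D (F (X t)) = 0 := by
  have hFX : Tendsto (fun h : ℝ => F (X (t + h))) (𝓝[≠] 0) (𝓝 (F (X t))) := by
    have hc : Tendsto (fun h : ℝ => X (t + h)) (𝓝[≠] 0) (𝓝 (X t)) := by
      have h1 : Tendsto (fun h : ℝ => t + h) (𝓝[≠] 0) (𝓝 t) :=
        tendsto_nhdsWithin_of_tendsto_nhds (Continuous.tendsto' (by fun_prop) _ _ (add_zero t))
      exact hV.continuousAt.tendsto.comp h1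
    rw [tendsto_iff_norm_sub_tendsto_zero] at hc ⊢
    exact squeeze_zero (fun _ => norm_nonneg _) (fun h => hF _ _) (by simpa using hc.const_mul K)
  have hlim := hD.tendsto_slope_zero.inner (𝕜 := ℝ) hFX
  refine tendsto_nhds_unique hlim ?_
  have herr : Tendsto (fun h : ℝ => ‖W t‖ * (K * ‖h⁻¹ • (X (t + h) - X t) - V‖))
      (𝓝[≠] 0) (𝓝 0) := by
    have := tendsto_iff_norm_sub_tendsto_zero.1 hV.tendsto_slope_zero
    simpa using (this.const_mul K).const_mul ‖W t‖
  refine squeeze_zero_norm' ?_ herr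
  have hX' : ∀ᶠ h in 𝓝[≠] (0:ℝ), inner ℝ (W (t + h)) (F (X (t + h))) = 0 := by
    have h1 : Tendsto (fun h : ℝ => t + h) (𝓝[≠] 0) (𝓝 t) :=
      tendsto_nhdsWithin_of_tendsto_nhds (Continuous.tendsto' (by fun_prop) _ _ (add_zero t))
    exact h1.eventually hX
  filter_upwards [hX', self_mem_nhdsWithin] with h hh h0
  have hne : h ≠ 0 := h0
  -- The two vanishing pairings leave only the deviation of `X (t + h)` from its tangent line, which
  -- is `o(h)`.
  have e1 : inner ℝ (h⁻¹ • (W (t + h) - W t)) (F (X (t + h)))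
      = -(h⁻¹ * inner ℝ (W t) (F (X (t + h)) - F (X t + h • V))) := by
    rw [real_inner_smul_left, inner_sub_left, inner_sub_right, hh, hline]
    ring
  rw [e1, norm_neg, norm_mul, norm_inv]
  have e2 : X (t + h) - (X t + h • V) = h • (h⁻¹ • (X (t + h) - X t) - V) := by
    rw [smul_sub, smul_inv_smul₀ hne]; abel
  have h3 : 0 < ‖h‖ := norm_pos_iff.2 hne
  rw [inv_mul_le_iff₀ h3]
  calc ‖inner ℝ (W t) (F (X (t + h)) - F (X t + h • V))‖
      ≤ ‖W t‖ * ‖F (X (t + h)) - F (X t + h • V)‖ := norm_inner_le_norm _ _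
    _ ≤ ‖W t‖ * (K * ‖X (t + h) - (X t + h • V)‖) := by gcongr; exact hF _ _
    _ = ‖h‖ * (‖W t‖ * (K * ‖h⁻¹ • (X (t + h) - X t) - V‖)) := by
      rw [e2, norm_smul]; ring

theorem starProjection_eq_velocity {μ : Measure ℝ} [IsFiniteMeasure μ] {X Z : ℝ → Lp ℝ 2 μ}
    {V Y : Lp ℝ 2 μ} {t : ℝ} (ht : 0 < t) (hX : ∀ s, 0 ≤ s → X s = projCone μ (Z s))
    (hZ : HasDerivAt Z Y t) (hV : HasDerivAt X V t) :
    (closedSpan μ (X t)).starProjection Y = V := by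
  have hmem : ∀ s, 0 ≤ s → X s ∈ monotoneCone μ := fun s hs => hX s hs ▸ projCone_mem μ _
  have horth : ∀ s, 0 ≤ s → ∀ W ∈ closedSpan μ (X s), inner ℝ (Z s - X s) W = 0 := by
    intro s hs W hW
    rw [hX s hs] at hW ⊢
    exact inner_sub_projCone_eq_zero _ hW
  obtain ⟨S, hS, hlev⟩ := exists_ae_velocity_eq_on_levels ht hmem hV
  have hVmem : V ∈ closedSpan μ (X t) := mem_closedSpan_of_eq_on_levels hS hlev
  refine Submodule.eq_starProjection_of_mem_of_inner_eq_zero hVmem ?_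
  have hle : closedSpan μ (X t) ≤ (ℝ ∙ (Y - V))ᗮ := by
    refine Submodule.topologicalClosure_minimal _ ?_ (Submodule.isClosed_orthogonal _)
    rintro W ⟨φ, hφ, hφc, hW⟩
    rw [Submodule.mem_orthogonal_singleton_iff_inner_right]
    obtain ⟨K, hK⟩ := hφ.lipschitzWith_of_hasCompactSupport hφc (by simp)
    obtain ⟨F, hF, hFK⟩ := exists_norm_sub_le_of_lipschitz (μ := μ) hK
    have hWF : W = F (X t) := by
      refine Lp.ext ?_
      filter_upwards [hW, hF (X t)] with m h1 h2
      rw [h1, h2]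
    rw [hWF]
    refine inner_deriv_eq_zero (W := fun s => Z s - X s) hFK hV (hZ.sub hV) ?_ fun h => ?_
    · filter_upwards [lt_mem_nhds ht] with s hs
      exact horth s hs.le _ (Submodule.le_topologicalClosure _ ⟨φ, hφ, hφc, hF _⟩)
    -- Since `V` is constant on level sets of `X t`, so is `φ ∘ (X t + h V)`.
    · refine horth t ht.le _ (mem_closedSpan_of_eq_on_levels
        (inter_mem hS (inter_mem (hF (X t + h • V))
          (inter_mem (Lp.coeFn_add (X t) (h • V)) (Lp.coeFn_smul h V)))) ?_)
      rintro m₁ ⟨a1, a2, a3, a4⟩ m₂ ⟨b1, b2, b3, b4⟩ hm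
      have key : ∀ m, F (X t + h • V) m = φ ((X t + h • V : Lp ℝ 2 μ) m) →
          (X t + h • V : Lp ℝ 2 μ) m = X t m + (h • V : Lp ℝ 2 μ) m →
          (h • V : Lp ℝ 2 μ) m = h * V m → F (X t + h • V) m = φ (X t m + h * V m) := by
        intro m e1 e2 e3
        rw [e1, e2, e3]
      rw [key m₁ a2 a3 a4, key m₂ b2 b3 b4, hm, hlev m₁ a1 m₂ b1 hm]
  intro W hW
  exact (Submodule.mem_orthogonal_singleton_iff_inner_right).1 (hle hW)

/-! ### Regularity of the free and the projected curve -/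

section Primitive

variable {E : Type*} [NormedAddCommGroup E] {Y : ℝ → E}

theorem intervalIntegrable_of_continuousOn_Ici (hY : ContinuousOn Y (Ici 0)) {a b : ℝ}
    (ha : 0 ≤ a) (hb : 0 ≤ b) : IntervalIntegrable Y volume a b :=
  (hY.mono fun _ hx => (le_min ha hb).trans hx.1).intervalIntegrable

variable [NormedSpace ℝ E]

theorem hasDerivAt_primitive_of_continuousOn_Ici [CompleteSpace E]
    (hY : ContinuousOn Y (Ici 0)) {t : ℝ} (ht : 0 < t) :
    HasDerivAt (fun u => ∫ s in (0:ℝ)..u, Y s) (Y t) t :=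
  intervalIntegral.integral_hasDerivAt_right
    (intervalIntegrable_of_continuousOn_Ici hY le_rfl ht.le)
    ((hY.mono Ioi_subset_Ici_self).stronglyMeasurableAtFilter isOpen_Ioi t ht)
    (hY.continuousAt (Ici_mem_nhds ht))

theorem exists_lipschitzOnWith_primitive (hY : ContinuousOn Y (Ici 0)) (T : ℝ) :
    ∃ K, LipschitzOnWith K (fun u => ∫ s in (0:ℝ)..u, Y s) (Icc 0 T) := by
  obtain ⟨M, hM⟩ := isCompact_Icc.exists_bound_of_continuousOn
    (hY.mono (Icc_subset_Ici_self : Icc 0 T ⊆ Ici 0))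
  refine ⟨M.toNNReal, LipschitzOnWith.of_dist_le_mul fun u hu v hv => ?_⟩
  rw [dist_eq_norm, intervalIntegral.integral_interval_sub_left
    (intervalIntegrable_of_continuousOn_Ici hY le_rfl hu.1)
    (intervalIntegrable_of_continuousOn_Ici hY le_rfl hv.1), Real.dist_eq]
  refine intervalIntegral.norm_integral_le_of_norm_le_const fun s hs => ?_
  refine (hM s ?_).trans (Real.le_coe_toNNReal M)
  exact (uIcc_subset_Icc hv hu) (uIoc_subset_uIcc hs)

end Primitive

end StickyParticles

theorem proposition4p1 (μ : Measure ℝ) [IsProbabilityMeasure μ]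
    (hμ : Integrable (fun x : ℝ => x ^ 2) μ)
    (Xbar : Lp ℝ 2 μ) (hXbar : Xbar ∈ StickyParticles.monotoneCone μ)
    (Y : ℝ → Lp ℝ 2 μ) (hY : ContinuousOn Y (Set.Ici 0))
    (X : ℝ → Lp ℝ 2 μ)
    (hX : ∀ t : ℝ, 0 ≤ t →
      X t = StickyParticles.projCone μ (Xbar + ∫ s in (0 : ℝ)..t, Y s)) :
    ∀ᵐ t ∂(volume.restrict (Set.Ici (0 : ℝ))),
      HasDerivAt X ((StickyParticles.closedSpan μ (X t)).starProjection (Y t)) t := by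
  have hd : ∀ᵐ t, 0 < t → DifferentiableAt ℝ X t := by
    have : Fact ((2 : ENNReal) ≠ ⊤) := ⟨by simp⟩
    refine StickyParticles.ae_differentiableAt_of_lipschitzOnWith_Icc fun T _ => ?_
    obtain ⟨K, hK⟩ := StickyParticles.exists_lipschitzOnWith_primitive hY T
    refine ⟨K, LipschitzOnWith.of_dist_le_mul fun u hu v hv => ?_⟩
    refine le_trans ?_ (hK.dist_le_mul u hu v hv)
    rw [hX u hu.1, hX v hv.1, dist_eq_norm, dist_eq_norm]
    refine (StickyParticles.norm_projCone_sub_le _ _).trans_eq ?_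
    rw [add_sub_add_left_eq_sub]
  -- The endpoint is discarded because the derivative is two-sided.
  have h0 : ∀ᵐ t : ℝ, t ≠ 0 := by simp [ae_iff]
  rw [ae_restrict_iff' measurableSet_Ici]
  filter_upwards [hd, h0] with t ht hne ht0
  have hpos : 0 < t := lt_of_le_of_ne ht0 (Ne.symm hne)
  have hV := (ht hpos).hasDerivAt
  rwa [StickyParticles.starProjection_eq_velocity hpos hX
    ((StickyParticles.hasDerivAt_primitive_of_continuousOn_Ici hY hpos).const_add Xbar) hV]
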